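/- **Corollary 2 (Existence).** Consider a finite directed rooted tree whose root is the single destination and whose other nodes $i\in\mathcal N$ are the origins. Link $i$ joins origin $i$ to its parent and ends in a bottleneck of capacity $\mu_i$. For $i\in\mathcal N$ let $\underline{\mathcal N}(i)$ be the set of $i$ and its ancestors other than the root, $\overline{\mathcal N}(i)$ the set of $i$ and its descendants, and $\mathcal B(i)$ the set of children of $i$. Assume $\mu_i>0$ and $\sum_{j\in\mathcal B(i)}\mu_j\le\mu_i$ for all $i\in\mathcal N$, and let $Q_i\ge 0$ be the demands. For a period $\mathcal T=[a,b]$, an integrable schedule delay cost $c:\mathcal T\to[0,\infty)$ and free-flow travel times $d_i$, the dynamic system optimal problem [DSO] is to minimize $$f(\boldsymbol q,\boldsymbol w)=\sum_{i\in\mathcal N}\int_{\mathcal T}\Big(c(t)+\sum_{j\in\underline{\mathcal N}(i)}(w_j(t)+d_j)\Big)q_i(t)\,\mathrm dt$$ over integrable inflow rates $q_i:\mathcal T\to\mathbb R$ and absolutely continuous queueing delays $w_i:\mathcal T\to[0,\infty)$ with $w_i(a)=0$ (the network is free of queues at the beginning of the period), $i\in\mathcal N$, such that for all $i\in\mathcal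 N$ and almost every $t\in\mathcal T$ $$\sum_{j\in\overline{\mathcal N}(i)}q_j(t)=\mu_i\dot\sigma_i(t)\ \text{ if } w_i(t)>0,\qquad \sum_{j\in\overline{\mathcal N}(i)}q_j(t)\le\mu_i\dot\sigma_i(t)\ \text{ if } w_i(t)=0,$$ $$q_i(t)\ge 0,\qquad \sum_{j\in\underline{\mathcal N}(i)}\dot w_j(t)<1,\qquad \int_{\mathcal T}q_i(s)\,\mathrm ds=Q_i,$$ where $\dot\sigma_i(t)=1-\sum_{j\in\underline{\mathcal N}(i)\setminus\{i\}}\dot w_j(t)$. The linear program [DSO-LP] is to minimize $\sum_{i\in\mathcal N}\int_{\mathcal T}\big(c(t)+\sum_{j\in\underline{\mathcal N}(i)}d_j\big)q_i(t)\,\mathrm dt$ over integrable $\boldsymbol q$ with $\sum_{j\in\overline{\mathcal N}(i)}q_j(t)\le\mu_i$ and $q_i(t)\ge0$ for almost every $t\in\mathcal T$, and $\int_{\mathcal T}q_i(t)\,\mathrm dt=Q_i$, for all $i\in\mathcal N$. Then [DSO] has an optimal solution whenever the period is sufficiently long: there is $T_0>0$, depending only on the network, the capacities and the demands, such that for every period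 $\mathcal T=[a,b]$ with $b-a\ge T_0$ and all $c$ and $d$ as above, [DSO-LP] has an optimal solution $\boldsymbol q$, and $(\boldsymbol q,\boldsymbol 0)$ is an optimal solution of [DSO]. -/

import Mathlib

open MeasureTheory

noncomputable section

namespace TreeDSO

/-- The origins of a rooted tree network: all nodes except the root `⊥`, which is the destination.
In the tree order `i ≤ j` says that `i` lies on the path from `j` to the root, and
`Order.pred i` is the parent of `i`. Link `i` joins the origin `i` to its parent, so the
origins also index the links. -/
abbrev Origin (R : RootedTree) : Type _ := {i : R // i ≠ ⊥}

variable {R : RootedTree} [Fintype (Origin R)]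

open Classical in
/-- The origin `i` together with its ancestors other than the destination. -/
def downstream (i : Origin R) : Finset (Origin R) :=
  Finset.univ.filter fun j => j ≤ i

open Classical in
/-- The origin `i` together with its descendants. -/
def upstream (i : Origin R) : Finset (Origin R) :=
  Finset.univ.filter fun j => i ≤ j

open Classical in
/-- The incoming links of the node `i`, i.e. the children of `i`. -/
def incoming (i : Origin R) : Finset (Origin R) :=
  Finset.univ.filter fun j => Order.pred (j : R) = (i : R)

open Classical in
/-- The time derivative of the departure time
`σ i t = t - ∑ w j t - ∑ d j` (both sums over the links strictly downstream of `i`)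
from the bottleneck `i`, for the commuters who reach the destination at time `t`. -/
def sigmaDot (w : Origin R → ℝ → ℝ) (i : Origin R) (t : ℝ) : ℝ :=
  1 - ∑ j ∈ downstream i \ {i}, deriv (w j) t

/-- The total system cost: schedule delay, queueing delay and free-flow travel times of all
commuters with destination arrival time in the assignment period `[a, b]`. -/
def totalCost (c : ℝ → ℝ) (d : Origin R → ℝ) (a b : ℝ) (q w : Origin R → ℝ → ℝ) : ℝ :=
  ∑ i, ∫ t in Set.Icc a b, (c t + ∑ j ∈ downstream i, (w j t + d j)) * q i t

/-- Feasible inflow rates `q` and queueing delays `w` of the problem [DSO] on the assignment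
period `[a, b]`, for bottleneck capacities `μ` and demands `Q`. -/
structure IsFeasible (μ Q : Origin R → ℝ) (a b : ℝ) (q w : Origin R → ℝ → ℝ) : Prop where
  /-- The inflow rates are integrable on the period. -/
  integrable_q : ∀ i, IntegrableOn (q i) (Set.Icc a b)
  /-- The queueing delays are absolutely continuous, so that they have derivatives a.e. and are
  the integrals of these. -/
  ac_w : ∀ i, AbsolutelyContinuousOnInterval (w i) a b
  /-- Queueing delays are nonnegative. -/
  nonneg_w : ∀ i, ∀ t ∈ Set.Icc a b, 0 ≤ w i t
  /-- There are no queues at the beginning of the period. -/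
  init_w : ∀ i, w i a = 0
  /-- A bottleneck with a queue discharges at capacity. -/
  queue_of_pos : ∀ i, ∀ᵐ t ∂(volume.restrict (Set.Icc a b)),
    0 < w i t → ∑ j ∈ upstream i, q j t = μ i * sigmaDot w i t
  /-- A bottleneck without a queue discharges at most at capacity. -/
  queue_of_zero : ∀ i, ∀ᵐ t ∂(volume.restrict (Set.Icc a b)),
    w i t = 0 → ∑ j ∈ upstream i, q j t ≤ μ i * sigmaDot w i t
  /-- Demand conservation. -/
  demand : ∀ i, ∫ t in Set.Icc a b, q i t = Q i
  /-- Inflow rates are nonnegative. -/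
  nonneg_q : ∀ i, ∀ᵐ t ∂(volume.restrict (Set.Icc a b)), 0 ≤ q i t
  /-- The arrival time at each bottleneck has positive derivative. -/
  tau_mono : ∀ i, ∀ᵐ t ∂(volume.restrict (Set.Icc a b)),
    ∑ j ∈ downstream i, deriv (w j) t < 1

/-- `(q, w)` is an optimal solution (a global minimizer) of [DSO]. -/
def IsOptimal (μ Q : Origin R → ℝ) (c : ℝ → ℝ) (d : Origin R → ℝ) (a b : ℝ)
    (q w : Origin R → ℝ → ℝ) : Prop :=
  IsFeasible μ Q a b q w ∧
    ∀ q' w', IsFeasible μ Q a b q' w' → totalCost c d a b q w ≤ totalCost c d a b q' w'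

/-- The objective function of the linear program [DSO-LP]. -/
def lpCost (c : ℝ → ℝ) (d : Origin R → ℝ) (a b : ℝ) (q : Origin R → ℝ → ℝ) : ℝ :=
  ∑ i, ∫ t in Set.Icc a b, (c t + ∑ j ∈ downstream i, d j) * q i t

/-- Feasible points of the linear program [DSO-LP]. -/
structure IsLPFeasible (μ Q : Origin R → ℝ) (a b : ℝ) (q : Origin R → ℝ → ℝ) : Prop where
  /-- The inflow rates are integrable on the period. -/
  integrable_q : ∀ i, IntegrableOn (q i) (Set.Icc a b)
  /-- Bottleneck capacity constraint. -/
  capacity : ∀ i, ∀ᵐ t ∂(volume.restrict (Set.Icc a b)), ∑ j ∈ upstream i, q j t ≤ μ i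
  /-- Demand conservation. -/
  demand : ∀ i, ∫ t in Set.Icc a b, q i t = Q i
  /-- Inflow rates are nonnegative. -/
  nonneg_q : ∀ i, ∀ᵐ t ∂(volume.restrict (Set.Icc a b)), 0 ≤ q i t

/-- `q` is an optimal solution of the linear program [DSO-LP]. -/
def IsLPOptimal (μ Q : Origin R → ℝ) (c : ℝ → ℝ) (d : Origin R → ℝ) (a b : ℝ)
    (q : Origin R → ℝ → ℝ) : Prop :=
  IsLPFeasible μ Q a b q ∧
    ∀ q', IsLPFeasible μ Q a b q' → lpCost c d a b q ≤ lpCost c d a b q'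

end TreeDSO

end

/-!
Since `∑ i, q i` splits into the flows through the links to the destination, the cost of [DSO-LP] is,
up to a constant, the sum over these links `r` of `∫ c * y r`, where `y i = ∑ j ∈ upstream i, q j`.
It therefore suffices to find a feasible `q` without queues for which, at every level `s`, the flow
`∫ y r` over the sublevel set `S = {c ≤ s}` is at least as large as in every feasible point of [DSO],
with or without queues: the layer cake formula for `c` (`integral_mul_le_of_setIntegral_sublevel_le`)
then compares the costs, and the queueing costs of the other point are nonnegative.

The flow is built from the leaves towards the destination (`thresholdFlow`). The origin `i` fills the
capacity left free by its incoming links at the times in a set `E i`, which consists of a strict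
sublevel set of `c` and a part of a level set and is chosen to meet the demand `Q i`. The period is
long enough for this as soon as `∑ j ∈ upstream i, Q j ≤ μ i * (b - a)` for all `i`. Every sublevel
set `S` is comparable with every `E i`, so that the flow through link `i` during `S` is computed
exactly: it is `m i * |S| + D i`, where `m i = μ i` and `D i = 0` if `S ⊆ E i`, while otherwise
`m i` is the sum of the rates `m k` of the children and `D i` is `Q i` plus the sum of their `D k`
(`setIntegral_thresholdFlow`; `m` and `D` are `levelRate` and `levelStock`).

With queues, `y i` may exceed `μ i` during times when a downstream queue decreases. For a feasible
point `(q, w)` of [DSO] it is shown instead, again from the leaves, that almost everywhere the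
positive part of `y i - m i * sigmaDot w i` is at most `F i`, where `F i = 0` if `S ⊆ E i` and
`F i = q i - m i * deriv (w i) + ∑ F k` otherwise (`IsFeasible.le_excessBound`). The assumption
`∑ μ k ≤ μ i` enters through `m i ≤ μ i`. As `w i` starts at zero and ends nonnegative, the integral
of `F i` is at most `D i`. At a link `r` to the destination `sigmaDot w r = 1`, so that the flow
during `S` is at most `m r * |S| + D r` (`IsFeasible.setIntegral_sum_upstream_le`).
-/

/-! ### Sums and recursion over the tree -/

namespace TreeDSO

variable {R : RootedTree}

theorem pred_lt (k : Origin R) : Order.pred (k : R) < k :=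
  Order.pred_lt_of_not_isMin (by simpa [isMin_iff_eq_bot] using k.2)

theorem le_pred_iff_lt (x : R) (k : Origin R) : x ≤ Order.pred (k : R) ↔ x < k :=
  Order.le_pred_iff_of_not_isMin (by simpa [isMin_iff_eq_bot] using k.2)

/-- The step from `x` towards a strict descendant `y` leads to a child of `x`. -/
theorem exists_pred_eq_of_lt {x y : R} (h : x < y) :
    ∃ k : Origin R, Order.pred (k : R) = x ∧ (k : R) ≤ y := by
  classical
  -- Minimality of `n` keeps the iterate before `x` away from `⊥`, which `Order.pred` fixes.
  have hex : ∃ n, Order.pred^[n] y = x := h.le.exists_pred_iterate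
  obtain ⟨n, hn, hmin⟩ : ∃ n, Order.pred^[n] y = x ∧ ∀ m < n, Order.pred^[m] y ≠ x :=
    ⟨Nat.find hex, Nat.find_spec hex, fun m hm => Nat.find_min hex hm⟩
  cases n with
  | zero => exact absurd hn h.ne'
  | succ n =>
    rw [Function.iterate_succ_apply'] at hn
    refine ⟨⟨Order.pred^[n] y, fun h0 => hmin n n.lt_succ_self ?_⟩, hn, Order.pred_iterate_le n y⟩
    rw [← hn, h0, Order.pred_bot]

theorem eq_of_pred_eq_of_le {k l : Origin R} (hp : Order.pred (k : R) = Order.pred (l : R)) {y : R}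
    (hk : (k : R) ≤ y) (hl : (l : R) ≤ y) : k = l := by
  have key : ∀ {k l : Origin R}, Order.pred (k : R) = Order.pred (l : R) → (k : R) ≤ l → k = l := by
    intro k l hp hkl
    rcases hkl.lt_or_eq with hlt | heq
    · exact absurd ((le_pred_iff_lt _ _).2 hlt) (hp ▸ (pred_lt k).not_ge)
    · exact Subtype.ext heq
  rcases le_total_of_directed hk hl with h | h
  · exact (key hp.symm h).symm
  · exact key hp h

variable [Fintype (Origin R)]

open Classical in
/-- The links that end in the node `x`, which may be the destination. -/
noncomputable def childLinks (x : R) : Finset (Origin R) :=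
  Finset.univ.filter fun j => Order.pred (j : R) = x

theorem mem_childLinks {x : R} {j : Origin R} : j ∈ childLinks x ↔ Order.pred (j : R) = x := by
  simp [childLinks]

theorem incoming_eq_childLinks (i : Origin R) : incoming i = childLinks (i : R) := rfl

theorem mem_incoming {i j : Origin R} : j ∈ incoming i ↔ Order.pred (j : R) = i := by
  simp [incoming]

theorem mem_upstream {i j : Origin R} : j ∈ upstream i ↔ i ≤ j := by
  simp [upstream]

theorem mem_downstream {i j : Origin R} : j ∈ downstream i ↔ j ≤ i := by
  simp [downstream]

theorem lt_of_mem_incoming {i k : Origin R} (h : k ∈ incoming i) : i < k := by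
  have := pred_lt k
  rw [mem_incoming.1 h] at this
  exact this

open Classical in
theorem filter_lt_eq_biUnion (x : R) :
    (Finset.univ.filter fun j : Origin R => x < (j : R)) = (childLinks x).biUnion upstream := by
  ext j
  simp only [Finset.mem_filter, Finset.mem_univ, true_and, Finset.mem_biUnion, mem_childLinks,
    mem_upstream]
  constructor
  · exact exists_pred_eq_of_lt
  · rintro ⟨k, rfl, hkj⟩
    exact (pred_lt k).trans_le hkj

open Classical in
theorem sum_filter_lt {M : Type*} [AddCommMonoid M] (x : R) (f : Origin R → M) :
    ∑ j with x < ((j : Origin R) : R), f j = ∑ k ∈ childLinks x, ∑ j ∈ upstream k, f j := by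
  rw [filter_lt_eq_biUnion, Finset.sum_biUnion]
  intro k hk l hl hkl
  refine Finset.disjoint_left.2 fun j hj hj' => hkl ?_
  exact eq_of_pred_eq_of_le ((mem_childLinks.1 hk).trans (mem_childLinks.1 hl).symm)
    (mem_upstream.1 hj) (mem_upstream.1 hj')

theorem sum_upstream {M : Type*} [AddCommMonoid M] (i : Origin R) (f : Origin R → M) :
    ∑ j ∈ upstream i, f j = f i + ∑ k ∈ incoming i, ∑ j ∈ upstream k, f j := by
  classical
  rw [incoming_eq_childLinks, ← sum_filter_lt]
  have : upstream i = insert i (Finset.univ.filter fun j : Origin R => (i : R) < (j : R)) := by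
    ext j
    simp [mem_upstream, le_iff_eq_or_lt, eq_comm]
  rw [this, Finset.sum_insert (by simp)]

theorem sum_univ {M : Type*} [AddCommMonoid M] (f : Origin R → M) :
    ∑ j, f j = ∑ k ∈ childLinks (⊥ : R), ∑ j ∈ upstream k, f j := by
  classical
  rw [← sum_filter_lt]
  congr 1
  ext j
  simp [bot_lt_iff_ne_bot, j.2]

open Classical in
theorem downstream_sdiff_of_mem_incoming {i k : Origin R} (h : k ∈ incoming i) :
    downstream k \ {k} = downstream i := by
  ext j
  have h1 := le_pred_iff_lt (j : R) k
  rw [mem_incoming.1 h] at h1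
  simp only [Finset.mem_sdiff, mem_downstream, Finset.mem_singleton]
  rw [← lt_iff_le_and_ne]
  exact h1.symm

open Classical in
theorem downstream_sdiff_of_pred_eq_bot {r : Origin R} (h : Order.pred (r : R) = ⊥) :
    downstream r \ {r} = ∅ := by
  ext j
  have h1 := le_pred_iff_lt (j : R) r
  rw [h, le_bot_iff] at h1
  simp only [Finset.mem_sdiff, mem_downstream, Finset.mem_singleton, Finset.notMem_empty, iff_false]
  rw [← lt_iff_le_and_ne]
  exact fun hj => j.2 (h1.2 hj)

/-- Induction from the leaves towards the destination. -/
theorem leaf_induction {P : Origin R → Prop} (h : ∀ i, (∀ k ∈ incoming i, P k) → P i)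
    (i : Origin R) : P i :=
  (wellFounded_gt : WellFounded fun i j : Origin R => i > j).induction i fun i ih =>
    h i fun k hk => ih k (lt_of_mem_incoming hk)

/-- The recursion from the leaves towards the destination in which the value at `i` is computed by
`f i` from the sum of the values at the children of `i`. -/
noncomputable def treeFold {M : Type*} [AddCommMonoid M] (f : Origin R → M → M) : Origin R → M :=
  (wellFounded_gt : WellFounded fun i j : Origin R => i > j).fix fun i ih =>
    f i (∑ k ∈ (incoming i).attach, ih k (lt_of_mem_incoming k.2))

theorem treeFold_eq {M : Type*} [AddCommMonoid M] (f : Origin R → M → M) (i : Origin R) :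
    treeFold f i = f i (∑ k ∈ incoming i, treeFold f k) := by
  rw [treeFold, WellFounded.fix_eq]
  congr 1
  exact Finset.sum_attach (incoming i) (treeFold f)

/-- Every family `y` of link flows is generated by the inflow rates that balance it at the nodes. -/
theorem sum_upstream_sub_sum_incoming {M : Type*} [AddCommGroup M] (y : Origin R → M)
    (i : Origin R) : ∑ j ∈ upstream i, (y j - ∑ k ∈ incoming j, y k) = y i := by
  induction i using leaf_induction with
  | h i ih => rw [sum_upstream, Finset.sum_congr rfl ih, sub_add_cancel]

end TreeDSO

/-! ### Sublevel sets of prescribed mass and the layer cake comparison -/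

open Filter Topology in
theorem exists_quantile (ν : Measure ℝ) [IsFiniteMeasure ν] {Q : ℝ} (h0 : 0 < Q)
    (h1 : Q < ν.real Set.univ) :
    ∃ x, ν.real (Set.Iio x) ≤ Q ∧ Q ≤ ν.real (Set.Iic x) := by
  have hne : {x | Q ≤ ν.real (Set.Iic x)}.Nonempty := by
    have h := (ENNReal.tendsto_toReal (measure_ne_top ν Set.univ)).comp (tendsto_measure_Iic_atTop ν)
    exact ((h.eventually (lt_mem_nhds h1)).exists).imp fun x hx => le_of_lt hx
  have hbdd : BddBelow {x | Q ≤ ν.real (Set.Iic x)} := by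
    have h := tendsto_measure_iInter_atBot (μ := ν) (s := fun x : ℝ => Set.Iic x)
      (fun _ => measurableSet_Iic.nullMeasurableSet) (fun _ _ hxy => Set.Iic_subset_Iic.2 hxy)
      ⟨0, measure_ne_top _ _⟩
    have hI : ⋂ x : ℝ, Set.Iic x = ∅ :=
      iInter_Iic_eq_empty_iff.2 (by rw [Set.range_id']; exact not_bddBelow_univ)
    rw [hI, measure_empty] at h
    replace h := (ENNReal.tendsto_toReal ENNReal.zero_ne_top).comp h
    obtain ⟨x, hx⟩ := (h.eventually (gt_mem_nhds h0)).exists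
    refine ⟨x, fun y hy => le_of_not_gt fun hyx => ?_⟩
    exact absurd (hy.trans (measureReal_mono (Set.Iic_subset_Iic.2 hyx.le))) (not_le.2 hx)
  set x := sInf {x | Q ≤ ν.real (Set.Iic x)} with hx
  refine ⟨x, ?_, ?_⟩
  · obtain ⟨u, hu, hlt, hlim⟩ := exists_seq_strictMono_tendsto x
    have hU : ⋃ n, Set.Iic (u n) = Set.Iio x := iUnion_Iic_eq_Iio_of_lt_of_tendsto hlt hlim
    have h := tendsto_measure_iUnion_atTop (μ := ν) (s := fun n => Set.Iic (u n))
      (fun m n hmn => Set.Iic_subset_Iic.2 (hu.monotone hmn))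
    rw [hU] at h
    refine le_of_tendsto ((ENNReal.tendsto_toReal (measure_ne_top ν _)).comp h)
      (Eventually.of_forall fun n => ?_)
    exact (lt_of_not_ge fun hn => (hlt n).not_ge (csInf_le hbdd hn)).le
  · obtain ⟨u, hu, hlt, hlim⟩ := exists_seq_strictAnti_tendsto x
    have hI : ⋂ n, Set.Iic (u n) = Set.Iic x := by
      ext z
      simp only [Set.mem_iInter, Set.mem_Iic]
      exact ⟨fun h => ge_of_tendsto' hlim h, fun h n => h.trans (hlt n).le⟩
    have h := tendsto_measure_iInter_atTop (μ := ν) (s := fun n => Set.Iic (u n))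
      (fun n => measurableSet_Iic.nullMeasurableSet)
      (fun m n hmn => Set.Iic_subset_Iic.2 (hu.antitone hmn)) ⟨0, measure_ne_top _ _⟩
    rw [hI] at h
    refine ge_of_tendsto ((ENNReal.tendsto_toReal (measure_ne_top ν _)).comp h)
      (Eventually.of_forall fun n => ?_)
    obtain ⟨y, hy, hyn⟩ := exists_lt_of_csInf_lt hne (hlt n)
    exact le_trans hy (measureReal_mono (Set.Iic_subset_Iic.2 hyn.le))

theorem exists_subset_measureReal_eq (κ : Measure ℝ) [IsFiniteMeasure κ] [NullSingletonClass κ] {B : Set ℝ}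
    (hB : MeasurableSet B) {Q : ℝ} (h0 : 0 ≤ Q) (h1 : Q ≤ κ.real B) :
    ∃ A ⊆ B, MeasurableSet A ∧ κ.real A = Q := by
  rcases h0.eq_or_lt with rfl | h0
  · exact ⟨∅, Set.empty_subset _, MeasurableSet.empty, by simp⟩
  rcases h1.eq_or_lt with rfl | h1
  · exact ⟨B, subset_rfl, hB, rfl⟩
  obtain ⟨x, hx, hx'⟩ := exists_quantile (κ.restrict B) h0 (by simpa using h1)
  refine ⟨Set.Iic x ∩ B, Set.inter_subset_right, measurableSet_Iic.inter hB, ?_⟩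
  rw [← measureReal_restrict_apply measurableSet_Iic]
  refine le_antisymm (le_trans (le_of_eq ?_) hx) hx'
  exact (measureReal_congr Iio_ae_eq_Iic).symm

/-- An atomless measure takes every intermediate value on a set that is comparable with all the
sublevel sets of `c`: a strict sublevel set together with a part of one level set. -/
theorem exists_measureReal_eq_comparable (κ : Measure ℝ) [IsFiniteMeasure κ] [NullSingletonClass κ]
    {c : ℝ → ℝ} (hc : Measurable c) {Q : ℝ} (h0 : 0 ≤ Q) (h1 : Q ≤ κ.real Set.univ) :
    ∃ E, MeasurableSet E ∧ κ.real E = Q ∧ ∀ s, {t | c t ≤ s} ⊆ E ∨ E ⊆ {t | c t ≤ s} := by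
  rcases h0.eq_or_lt with rfl | h0
  · exact ⟨∅, MeasurableSet.empty, by simp, fun s => Or.inr (Set.empty_subset _)⟩
  rcases h1.eq_or_lt with rfl | h1
  · exact ⟨Set.univ, MeasurableSet.univ, rfl, fun s => Or.inl (Set.subset_univ _)⟩
  -- The critical level is a quantile of the law of `c`.
  obtain ⟨x, hx, hx'⟩ := exists_quantile (κ.map c) h0
    (by rwa [map_measureReal_apply hc MeasurableSet.univ])
  rw [map_measureReal_apply hc measurableSet_Iio] at hx
  rw [map_measureReal_apply hc measurableSet_Iic] at hx'
  have hd : Disjoint (c ⁻¹' Set.Iio x) (c ⁻¹' {x}) := by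
    refine Set.disjoint_left.2 fun t ht ht' => ?_
    simp_all
  have hu : c ⁻¹' Set.Iic x = c ⁻¹' Set.Iio x ∪ c ⁻¹' {x} := by
    rw [← Set.preimage_union, ← Set.Iio_union_right]
  have hmx : MeasurableSet (c ⁻¹' {x}) := hc (measurableSet_singleton x)
  rw [hu, measureReal_union hd hmx] at hx'
  obtain ⟨A, hA, hAm, hAQ⟩ := exists_subset_measureReal_eq κ hmx
    (Q := Q - κ.real (c ⁻¹' Set.Iio x)) (by linarith) (by linarith)
  refine ⟨c ⁻¹' Set.Iio x ∪ A, (hc measurableSet_Iio).union hAm, ?_, fun s => ?_⟩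
  · rw [measureReal_union (hd.mono_right hA) hAm, hAQ]
    ring
  · rcases lt_or_ge s x with hs | hs
    · exact Or.inl fun t ht => Or.inl (lt_of_le_of_lt ht hs)
    · refine Or.inr (Set.union_subset (fun t ht => (le_of_lt ht).trans hs) fun t ht => ?_)
      have : c t = x := hA ht
      exact this.trans_le hs

theorem exists_setIntegral_eq_comparable {a b : ℝ} {c g : ℝ → ℝ} (hc : Measurable c)
    (hg : IntegrableOn g (Set.Icc a b)) (hg0 : ∀ t, 0 ≤ g t) {Q : ℝ} (h0 : 0 ≤ Q)
    (h1 : Q ≤ ∫ t in Set.Icc a b, g t) :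
    ∃ E, MeasurableSet E ∧ ∫ t in E, g t ∂(volume.restrict (Set.Icc a b)) = Q ∧
      ∀ s, {t | c t ≤ s} ⊆ E ∨ E ⊆ {t | c t ≤ s} := by
  set ν := volume.restrict (Set.Icc a b) with hν
  set κ := ν.withDensity fun t => ENNReal.ofReal (g t) with hκ
  have hreal : ∀ E, MeasurableSet E → κ.real E = ∫ t in E, g t ∂ν := by
    intro E hE
    rw [measureReal_def, hκ, withDensity_apply _ hE,
      integral_eq_lintegral_of_nonneg_ae (Filter.Eventually.of_forall hg0)
        hg.aestronglyMeasurable.restrict]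
  have : IsFiniteMeasure κ := isFiniteMeasure_withDensity_ofReal hg.2
  obtain ⟨E, hE, hEQ, hcomp⟩ := exists_measureReal_eq_comparable κ hc h0
    (by rw [hreal _ MeasurableSet.univ, setIntegral_univ]; exact h1)
  exact ⟨E, hE, by rw [← hreal E hE, hEQ], hcomp⟩

/-- If two densities have the same total mass, then the one with more mass on every sublevel set of
`c` has the lower cost. This is the layer cake formula for `c`. -/
theorem integral_mul_le_of_setIntegral_sublevel_le {α : Type*} [MeasurableSpace α] {ν : Measure α}
    {c f g : α → ℝ} (hc : Measurable c) (hc0 : ∀ t, 0 ≤ c t)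
    (hf : Integrable f ν) (hg : Integrable g ν) (hf0 : 0 ≤ᵐ[ν] f) (hg0 : 0 ≤ᵐ[ν] g)
    (hcf : Integrable (fun t => c t * f t) ν) (heq : ∫ t, f t ∂ν = ∫ t, g t ∂ν)
    (hle : ∀ s, ∫ t in {t | c t ≤ s}, f t ∂ν ≤ ∫ t in {t | c t ≤ s}, g t ∂ν) :
    ∫ t, c t * g t ∂ν ≤ ∫ t, c t * f t ∂ν := by
  have key : ∀ {f : α → ℝ}, Integrable f ν → 0 ≤ᵐ[ν] f →
      ∫⁻ t, ENNReal.ofReal (c t * f t) ∂ν =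
        ∫⁻ s in Set.Ioi (0 : ℝ), ENNReal.ofReal (∫ t, f t ∂ν - ∫ t in {t | c t ≤ s}, f t ∂ν) := by
    intro f hf hf0
    have h := lintegral_eq_lintegral_meas_lt (ν.withDensity fun t => ENNReal.ofReal (f t))
      (Filter.Eventually.of_forall hc0) hc.aemeasurable
    rw [lintegral_withDensity_eq_lintegral_mul₀ hf.aemeasurable.ennreal_ofReal
      hc.ennreal_ofReal.aemeasurable] at h
    rw [lintegral_congr fun t => ENNReal.ofReal_mul (hc0 t)]
    simp only [Pi.mul_apply, mul_comm (ENNReal.ofReal (f _))] at h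
    rw [h]
    refine lintegral_congr fun s => ?_
    have hm : MeasurableSet {t | c t ≤ s} := hc measurableSet_Iic
    have hcompl : {t | s < c t} = {t | c t ≤ s}ᶜ := by ext; simp
    rw [hcompl, withDensity_apply _ hm.compl, ← integral_add_compl hm hf, add_sub_cancel_left,
      ofReal_integral_eq_lintegral_ofReal hf.integrableOn (ae_restrict_of_ae hf0)]
  have hcg0 : 0 ≤ᵐ[ν] fun t => c t * g t := hg0.mono fun t ht => mul_nonneg (hc0 t) ht
  have hcf0 : 0 ≤ᵐ[ν] fun t => c t * f t := hf0.mono fun t ht => mul_nonneg (hc0 t) ht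
  rw [integral_eq_lintegral_of_nonneg_ae hcg0 (hc.aestronglyMeasurable.mul hg.1),
    integral_eq_lintegral_of_nonneg_ae hcf0 hcf.1]
  refine ENNReal.toReal_mono ?_ ?_
  · exact ((hasFiniteIntegral_iff_ofReal hcf0).1 hcf.2).ne
  · rw [key hg hg0, key hf hf0, heq]
    exact lintegral_mono fun s => ENNReal.ofReal_le_ofReal (sub_le_sub_left (hle s) _)

/-! ### The queue-free flow that prefers times of low cost -/

namespace TreeDSO

variable {R : RootedTree} [Fintype (Origin R)]

open Classical in
/-- The flow through link `i`, as a function of the destination arrival time, when link `i` is used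
at capacity at the times in `E i`, and at the other times only carries the flow of its incoming
links. -/
noncomputable def thresholdFlow (μ : Origin R → ℝ) (E : Origin R → Set ℝ) : Origin R → ℝ → ℝ :=
  treeFold fun i s => (E i).piecewise (fun _ => μ i) s

/-- The inflow rate at the origin `i` that produces `thresholdFlow`: the capacity that the incoming
links leave free at the times in `E i`, and zero at the other times. -/
noncomputable def thresholdInflow (μ : Origin R → ℝ) (E : Origin R → Set ℝ) (i : Origin R) :
    ℝ → ℝ :=
  thresholdFlow μ E i - ∑ k ∈ incoming i, thresholdFlow μ E k

open Classical in
/-- The total capacity of the first links, on the ways from `i` (included) towards the leaves, that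
are used at capacity throughout `S`. Together with `levelStock` it bounds the flow through link `i`
during `S`, by `levelRate μ E S i * |S| + levelStock Q E S i`. -/
noncomputable def levelRate (μ : Origin R → ℝ) (E : Origin R → Set ℝ) (S : Set ℝ) : Origin R → ℝ :=
  treeFold fun i x => if S ⊆ E i then μ i else x

open Classical in
/-- The total demand of the origins at or upstream of `i` from which the way to `i` (both ends
included) uses no link at capacity throughout `S`. -/
noncomputable def levelStock (Q : Origin R → ℝ) (E : Origin R → Set ℝ) (S : Set ℝ) :
    Origin R → ℝ :=
  treeFold fun i x => if S ⊆ E i then 0 else Q i + x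

section flow

variable {μ Q : Origin R → ℝ} {E : Origin R → Set ℝ} {S : Set ℝ} {i : Origin R}

theorem levelRate_of_subset (h : S ⊆ E i) : levelRate μ E S i = μ i := by
  rw [levelRate, treeFold_eq, if_pos h]

theorem levelRate_of_not_subset (h : ¬ S ⊆ E i) :
    levelRate μ E S i = ∑ k ∈ incoming i, levelRate μ E S k := by
  rw [levelRate, treeFold_eq, if_neg h]

theorem levelStock_of_subset (h : S ⊆ E i) : levelStock Q E S i = 0 := by
  rw [levelStock, treeFold_eq, if_pos h]

theorem levelStock_of_not_subset (h : ¬ S ⊆ E i) :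
    levelStock Q E S i = Q i + ∑ k ∈ incoming i, levelStock Q E S k := by
  rw [levelStock, treeFold_eq, if_neg h]

theorem levelRate_nonneg (hμ : ∀ i, 0 < μ i) (i : Origin R) : 0 ≤ levelRate μ E S i := by
  induction i using leaf_induction with
  | h i ih =>
    by_cases h : S ⊆ E i
    · rw [levelRate_of_subset h]
      exact (hμ i).le
    · rw [levelRate_of_not_subset h]
      exact Finset.sum_nonneg ih

theorem levelRate_le (hcap : ∀ i, ∑ j ∈ incoming i, μ j ≤ μ i) (i : Origin R) :
    levelRate μ E S i ≤ μ i := by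
  induction i using leaf_induction with
  | h i ih =>
    by_cases h : S ⊆ E i
    · rw [levelRate_of_subset h]
    · rw [levelRate_of_not_subset h]
      exact (Finset.sum_le_sum ih).trans (hcap i)

theorem thresholdFlow_of_mem {t : ℝ} (h : t ∈ E i) : thresholdFlow μ E i t = μ i := by
  classical
  rw [thresholdFlow, treeFold_eq, Set.piecewise_eq_of_mem _ _ _ h]

theorem thresholdFlow_of_notMem {t : ℝ} (h : t ∉ E i) :
    thresholdFlow μ E i t = ∑ k ∈ incoming i, thresholdFlow μ E k t := by
  classical
  rw [thresholdFlow, treeFold_eq, Set.piecewise_eq_of_notMem _ _ _ h, Finset.sum_apply]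

theorem thresholdFlow_nonneg (hμ : ∀ i, 0 < μ i) (i : Origin R) (t : ℝ) :
    0 ≤ thresholdFlow μ E i t := by
  induction i using leaf_induction with
  | h i ih =>
    by_cases h : t ∈ E i
    · rw [thresholdFlow_of_mem h]
      exact (hμ i).le
    · rw [thresholdFlow_of_notMem h]
      exact Finset.sum_nonneg ih

theorem thresholdFlow_le (hcap : ∀ i, ∑ j ∈ incoming i, μ j ≤ μ i) (i : Origin R) (t : ℝ) :
    thresholdFlow μ E i t ≤ μ i := by
  induction i using leaf_induction with
  | h i ih =>
    by_cases h : t ∈ E i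
    · rw [thresholdFlow_of_mem h]
    · rw [thresholdFlow_of_notMem h]
      exact (Finset.sum_le_sum ih).trans (hcap i)

theorem sum_thresholdFlow_le (hcap : ∀ i, ∑ j ∈ incoming i, μ j ≤ μ i) (i : Origin R) (t : ℝ) :
    ∑ k ∈ incoming i, thresholdFlow μ E k t ≤ μ i :=
  (Finset.sum_le_sum fun k _ => thresholdFlow_le hcap k t).trans (hcap i)

theorem measurable_thresholdFlow (hE : ∀ i, MeasurableSet (E i)) (i : Origin R) :
    Measurable (thresholdFlow μ E i) := by
  classical
  induction i using leaf_induction with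
  | h i ih =>
    rw [thresholdFlow, treeFold_eq]
    exact Measurable.piecewise (hE i) measurable_const (Finset.sum_induction _ Measurable
      (fun _ _ => Measurable.add) measurable_const ih)

theorem integrable_thresholdFlow (hμ : ∀ i, 0 < μ i) (hcap : ∀ i, ∑ j ∈ incoming i, μ j ≤ μ i)
    (hE : ∀ i, MeasurableSet (E i)) (ν : Measure ℝ) [IsFiniteMeasure ν] (i : Origin R) :
    Integrable (thresholdFlow μ E i) ν :=
  Integrable.of_bound (measurable_thresholdFlow hE i).aestronglyMeasurable (μ i)
    (Filter.Eventually.of_forall fun t => by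
      rw [Real.norm_eq_abs, abs_of_nonneg (thresholdFlow_nonneg hμ i t)]
      exact thresholdFlow_le hcap i t)

theorem thresholdInflow_eq_indicator (i : Origin R) :
    thresholdInflow μ E i =
      (E i).indicator fun t => μ i - ∑ k ∈ incoming i, thresholdFlow μ E k t := by
  ext t
  by_cases h : t ∈ E i
  · simp [thresholdInflow, thresholdFlow_of_mem, h]
  · simp [thresholdInflow, thresholdFlow_of_notMem, h]

theorem thresholdInflow_nonneg (hcap : ∀ i, ∑ j ∈ incoming i, μ j ≤ μ i) (i : Origin R) (t : ℝ) :
    0 ≤ thresholdInflow μ E i t := by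
  rw [thresholdInflow_eq_indicator]
  exact Set.indicator_nonneg (fun t _ => sub_nonneg.2 (sum_thresholdFlow_le hcap i t)) t

theorem integrable_thresholdInflow (hμ : ∀ i, 0 < μ i) (hcap : ∀ i, ∑ j ∈ incoming i, μ j ≤ μ i)
    (hE : ∀ i, MeasurableSet (E i)) (ν : Measure ℝ) [IsFiniteMeasure ν] (i : Origin R) :
    Integrable (thresholdInflow μ E i) ν :=
  (integrable_thresholdFlow hμ hcap hE ν i).sub
    (integrable_finsetSum' _ fun k _ => integrable_thresholdFlow hμ hcap hE ν k)

theorem sum_upstream_thresholdInflow (i : Origin R) (t : ℝ) :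
    ∑ j ∈ upstream i, thresholdInflow μ E j t = thresholdFlow μ E i t := by
  rw [← Finset.sum_apply]
  exact congrFun (sum_upstream_sub_sum_incoming (thresholdFlow μ E) i) t

/-- If the demands are met and `S` is comparable with all the sets `E i`, then the flow through link
`i` during `S` is as large as the capacities and the demands allow. -/
theorem setIntegral_thresholdFlow (hμ : ∀ i, 0 < μ i) (hcap : ∀ i, ∑ j ∈ incoming i, μ j ≤ μ i)
    (hE : ∀ i, MeasurableSet (E i)) (ν : Measure ℝ) [IsFiniteMeasure ν]
    (hQ : ∀ i, ∫ t, thresholdInflow μ E i t ∂ν = Q i) (hS : MeasurableSet S)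
    (hSE : ∀ i, S ⊆ E i ∨ E i ⊆ S) (i : Origin R) :
    ∫ t in S, thresholdFlow μ E i t ∂ν = levelRate μ E S i * ν.real S + levelStock Q E S i := by
  induction i using leaf_induction with
  | h i ih =>
    by_cases h : S ⊆ E i
    · rw [levelRate_of_subset h, levelStock_of_subset h,
        setIntegral_congr_fun hS fun t ht => thresholdFlow_of_mem (h ht), setIntegral_const,
        smul_eq_mul]
      ring
    · have hES := (hSE i).resolve_left h
      have hsplit : ∀ t, thresholdFlow μ E i t =
          thresholdInflow μ E i t + ∑ k ∈ incoming i, thresholdFlow μ E k t := by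
        intro t
        simp [thresholdInflow]
      have hin : ∫ t in S, thresholdInflow μ E i t ∂ν = Q i := by
        rw [← hQ i]
        refine setIntegral_eq_integral_of_forall_compl_eq_zero fun t ht => ?_
        rw [thresholdInflow_eq_indicator]
        exact Set.indicator_of_notMem (fun h' => ht (hES h')) _
      simp_rw [hsplit]
      rw [integral_add (integrable_thresholdInflow hμ hcap hE _ i)
        (integrable_finsetSum _ fun k _ => integrable_thresholdFlow hμ hcap hE _ k),
        integral_finsetSum _ fun k _ => integrable_thresholdFlow hμ hcap hE _ k, hin,
        Finset.sum_congr rfl ih, Finset.sum_add_distrib, ← Finset.sum_mul,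
        levelRate_of_not_subset h, levelStock_of_not_subset h]
      ring

/-- The sets of times `E i` can be chosen, from the leaves towards the destination, such that they
are comparable with all the sublevel sets of `c` and such that the demands are met. -/
theorem exists_thresholdFlow (hμ : ∀ i, 0 < μ i) (hcap : ∀ i, ∑ j ∈ incoming i, μ j ≤ μ i)
    (hQ : ∀ i, 0 ≤ Q i) {a b : ℝ} (hab : a ≤ b)
    (hlen : ∀ i, ∑ j ∈ upstream i, Q j ≤ μ i * (b - a)) {c : ℝ → ℝ} (hc : Measurable c) :
    ∃ E : Origin R → Set ℝ, (∀ i, MeasurableSet (E i)) ∧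
      (∀ i s, {t | c t ≤ s} ⊆ E i ∨ E i ⊆ {t | c t ≤ s}) ∧
      ∀ i, ∫ t in Set.Icc a b, thresholdInflow μ E i t = Q i := by
  classical
  have hex : ∀ (i : Origin R) (g : ℝ → ℝ), ∃ E, MeasurableSet E ∧
      (∀ s, {t | c t ≤ s} ⊆ E ∨ E ⊆ {t | c t ≤ s}) ∧
      (IntegrableOn g (Set.Icc a b) → (∀ t, 0 ≤ g t) → Q i ≤ ∫ t in Set.Icc a b, g t →
        ∫ t in E, g t ∂(volume.restrict (Set.Icc a b)) = Q i) := by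
    intro i g
    by_cases h : IntegrableOn g (Set.Icc a b) ∧ (∀ t, 0 ≤ g t) ∧ Q i ≤ ∫ t in Set.Icc a b, g t
    · obtain ⟨E, h1, h2, h3⟩ := exists_setIntegral_eq_comparable hc h.1 h.2.1 (hQ i) h.2.2
      exact ⟨E, h1, h3, fun _ _ _ => h2⟩
    · exact ⟨∅, MeasurableSet.empty, fun s => Or.inr (Set.empty_subset _),
        fun h1 h2 h3 => absurd ⟨h1, h2, h3⟩ h⟩
  choose F hF hFc hFQ using hex
  -- `F i g` depends on the flow from upstream through the free capacity `g`, so the sets and the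
  -- flow are constructed together.
  set y : Origin R → ℝ → ℝ :=
    treeFold fun i s => (F i fun t => μ i - s t).piecewise (fun _ => μ i) s with hy
  set E : Origin R → Set ℝ := fun i => F i fun t => μ i - (∑ k ∈ incoming i, y k) t with hEdef
  have hyE : ∀ i, thresholdFlow μ E i = y i := by
    intro i
    induction i using leaf_induction with
    | h i ih =>
      rw [thresholdFlow, treeFold_eq, hy, treeFold_eq, ← hy]
      change (E i).piecewise (fun _ => μ i) (∑ k ∈ incoming i, thresholdFlow μ E k) = _
      rw [Finset.sum_congr rfl ih]
  have hE : ∀ i, MeasurableSet (E i) := fun i => hF _ _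
  have hflow := integrable_thresholdFlow hμ hcap hE (volume.restrict (Set.Icc a b))
  have hsum : ∀ i, Integrable (fun t => ∑ k ∈ incoming i, thresholdFlow μ E k t)
      (volume.restrict (Set.Icc a b)) := fun i => integrable_finsetSum _ fun k _ => hflow k
  refine ⟨E, hE, fun i s => hFc _ _ s, fun i => ?_⟩
  suffices h : ∫ t in Set.Icc a b, thresholdInflow μ E i t = Q i ∧
      ∫ t in Set.Icc a b, thresholdFlow μ E i t = ∑ j ∈ upstream i, Q j from h.1
  induction i using leaf_induction with
  | h i ih =>
    have hI : ∫ t in Set.Icc a b, ∑ k ∈ incoming i, thresholdFlow μ E k t =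
        ∑ k ∈ incoming i, ∑ j ∈ upstream k, Q j := by
      rw [integral_finsetSum _ fun k _ => hflow k]
      exact Finset.sum_congr rfl fun k hk => (ih k hk).2
    have hcong : ∀ t, (∑ k ∈ incoming i, y k) t = ∑ k ∈ incoming i, thresholdFlow μ E k t := by
      simp [hyE]
    have h1 : ∫ t in Set.Icc a b, thresholdInflow μ E i t = Q i := by
      rw [thresholdInflow_eq_indicator, integral_indicator (hE i)]
      have h := hFQ i fun t => μ i - (∑ k ∈ incoming i, y k) t
      change _ → _ → _ → ∫ t in E i, _ ∂_ = _ at h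
      simp only [hcong] at h
      refine h ((integrable_const _).sub (hsum i))
        (fun t => sub_nonneg.2 (sum_thresholdFlow_le hcap i t)) ?_
      rw [integral_sub (integrable_const _) (hsum i), hI, setIntegral_const, smul_eq_mul,
        Real.volume_real_Icc_of_le hab, mul_comm]
      have := hlen i
      rw [sum_upstream] at this
      linarith
    refine ⟨h1, ?_⟩
    have hsplit : ∀ t, thresholdFlow μ E i t =
        thresholdInflow μ E i t + ∑ k ∈ incoming i, thresholdFlow μ E k t := by
      intro t
      simp [thresholdInflow]
    simp_rw [hsplit]
    rw [integral_add (integrable_thresholdInflow hμ hcap hE _ i) (hsum i), h1, hI, sum_upstream]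

end flow

end TreeDSO

/-! ### Flows with queues -/

namespace TreeDSO

variable {R : RootedTree} [Fintype (Origin R)]

theorem sigmaDot_eq_one_sub_of_mem_incoming (w : Origin R → ℝ → ℝ) {i k : Origin R} (h : k ∈ incoming i)
    (t : ℝ) : sigmaDot w k t = 1 - ∑ j ∈ downstream i, deriv (w j) t := by
  rw [sigmaDot, downstream_sdiff_of_mem_incoming h]

theorem sigmaDot_eq_sub_deriv_of_mem_incoming (w : Origin R → ℝ → ℝ) {i k : Origin R} (h : k ∈ incoming i)
    (t : ℝ) : sigmaDot w k t = sigmaDot w i t - deriv (w i) t := by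
  classical
  rw [sigmaDot_eq_one_sub_of_mem_incoming w h, sigmaDot,
    ← Finset.sum_sdiff (Finset.singleton_subset_iff.2 (mem_downstream.2 (le_refl i))),
    Finset.sum_singleton]
  rw [sub_add_eq_sub_sub]

theorem sigmaDot_of_pred_eq_bot (w : Origin R → ℝ → ℝ) {r : Origin R}
    (h : Order.pred (r : R) = ⊥) (t : ℝ) : sigmaDot w r t = 1 := by
  rw [sigmaDot, downstream_sdiff_of_pred_eq_bot h, Finset.sum_empty, sub_zero]

section dso

variable {μ Q : Origin R → ℝ} {a b : ℝ} {q w : Origin R → ℝ → ℝ}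

theorem IsFeasible.integrableOn_deriv (h : IsFeasible μ Q a b q w) (hab : a ≤ b) (i : Origin R) :
    IntegrableOn (deriv (w i)) (Set.Icc a b) :=
  (intervalIntegrable_iff_integrableOn_Icc_of_le hab).1 (h.ac_w i).intervalIntegrable_deriv

theorem IsFeasible.integral_deriv_nonneg (h : IsFeasible μ Q a b q w) (hab : a ≤ b)
    (i : Origin R) : 0 ≤ ∫ t in Set.Icc a b, deriv (w i) t := by
  rw [integral_Icc_eq_integral_Ioc, ← intervalIntegral.integral_of_le hab,
    (h.ac_w i).integral_deriv_eq_sub, h.init_w i, sub_zero]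
  exact h.nonneg_w i b (Set.right_mem_Icc.2 hab)

theorem IsFeasible.deriv_eq_zero (h : IsFeasible μ Q a b q w) (i : Origin R) :
    ∀ᵐ t ∂(volume.restrict (Set.Icc a b)), w i t = 0 → deriv (w i) t = 0 := by
  -- In the interior of the period, a zero of the nonnegative `w i` is a local minimum.
  rw [← Measure.restrict_congr_set Ioo_ae_eq_Icc]
  filter_upwards [ae_restrict_mem measurableSet_Ioo] with t ht h0
  refine IsLocalMin.deriv_eq_zero ?_
  filter_upwards [Ioo_mem_nhds ht.1 ht.2] with s hs
  rw [h0]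
  exact h.nonneg_w i s (Set.Ioo_subset_Icc_self hs)

theorem IsFeasible.sigmaDot_nonneg (h : IsFeasible μ Q a b q w) (i : Origin R) :
    ∀ᵐ t ∂(volume.restrict (Set.Icc a b)), 0 ≤ sigmaDot w i t := by
  by_cases hi : Order.pred (i : R) = ⊥
  · exact Filter.Eventually.of_forall fun t => by
      rw [sigmaDot_of_pred_eq_bot w hi]
      exact zero_le_one
  · have hmem : i ∈ incoming (⟨Order.pred (i : R), hi⟩ : Origin R) := mem_incoming.2 rfl
    filter_upwards [h.tau_mono ⟨Order.pred (i : R), hi⟩] with t ht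
    rw [sigmaDot_eq_one_sub_of_mem_incoming w hmem]
    linarith

theorem IsFeasible.sum_upstream_le (h : IsFeasible μ Q a b q w) (i : Origin R) :
    ∀ᵐ t ∂(volume.restrict (Set.Icc a b)), ∑ j ∈ upstream i, q j t ≤ μ i * sigmaDot w i t := by
  filter_upwards [h.queue_of_pos i, h.queue_of_zero i, ae_restrict_mem measurableSet_Icc]
    with t h1 h2 ht
  rcases (h.nonneg_w i t ht).eq_or_lt with h0 | h0
  · exact h2 h0.symm
  · exact (h1 h0).le

open Classical in
/-- A bound for the flow through link `i` in excess of `levelRate μ E S i * sigmaDot w i`. Its integral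
over the period is at most `levelStock Q E S i`, because the queueing delays start at zero and end
nonnegative. -/
noncomputable def excessBound (μ : Origin R → ℝ) (E : Origin R → Set ℝ) (S : Set ℝ)
    (q w : Origin R → ℝ → ℝ) : Origin R → ℝ → ℝ :=
  treeFold fun i F => if S ⊆ E i then 0
    else fun t => q i t - levelRate μ E S i * deriv (w i) t + F t

variable {E : Origin R → Set ℝ} {S : Set ℝ} {i : Origin R}

theorem excessBound_of_subset (h : S ⊆ E i) : excessBound μ E S q w i = 0 := by
  rw [excessBound, treeFold_eq, if_pos h]

theorem excessBound_of_not_subset (h : ¬ S ⊆ E i) :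
    excessBound μ E S q w i = fun t => q i t - levelRate μ E S i * deriv (w i) t +
      ∑ k ∈ incoming i, excessBound μ E S q w k t := by
  rw [excessBound, treeFold_eq, if_neg h]
  simp only [Finset.sum_apply]

/-- Without a queue at `i`, the delay `w i` is stationary, and the excess over the rates of the
children is passed on; with a queue, link `i` discharges at capacity, so that the excess is
nonnegative, and a decrease of `w i` accounts for the difference in `sigmaDot` between `i` and its
children. -/
theorem IsFeasible.le_excessBound (h : IsFeasible μ Q a b q w)
    (hcap : ∀ i, ∑ j ∈ incoming i, μ j ≤ μ i) :
    ∀ᵐ t ∂(volume.restrict (Set.Icc a b)), ∀ i, 0 ≤ excessBound μ E S q w i t ∧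
      ∑ j ∈ upstream i, q j t - levelRate μ E S i * sigmaDot w i t ≤
        excessBound μ E S q w i t := by
  filter_upwards [ae_all_iff.2 h.queue_of_pos, ae_all_iff.2 h.sum_upstream_le,
    ae_all_iff.2 h.deriv_eq_zero, ae_all_iff.2 h.nonneg_q, ae_all_iff.2 h.sigmaDot_nonneg,
    ae_restrict_mem measurableSet_Icc] with t hpos hle hderiv hq hσ ht i
  induction i using leaf_induction with
  | h i ih =>
    by_cases hi : S ⊆ E i
    · rw [excessBound_of_subset hi, levelRate_of_subset hi]
      exact ⟨le_rfl, sub_nonpos.2 (hle i)⟩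
    · have hup : ∑ j ∈ upstream i, q j t - levelRate μ E S i * sigmaDot w i t ≤
          excessBound μ E S q w i t := by
        have hs : ∑ k ∈ incoming i, (∑ j ∈ upstream k, q j t -
            levelRate μ E S k * (sigmaDot w i t - deriv (w i) t)) ≤
            ∑ k ∈ incoming i, excessBound μ E S q w k t :=
          Finset.sum_le_sum fun k hk => sigmaDot_eq_sub_deriv_of_mem_incoming w hk t ▸ (ih k hk).2
        rw [Finset.sum_sub_distrib, ← Finset.sum_mul, ← levelRate_of_not_subset hi] at hs
        rw [excessBound_of_not_subset hi, sum_upstream i fun j => q j t]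
        linarith
      refine ⟨?_, hup⟩
      rcases (h.nonneg_w i t ht).eq_or_lt with h0 | h0
      · rw [excessBound_of_not_subset hi]
        dsimp only
        rw [hderiv i h0.symm]
        have := Finset.sum_nonneg fun k hk => (ih k hk).1
        have := hq i
        simp only [mul_zero, sub_zero]
        positivity
      · refine le_trans ?_ hup
        rw [hpos i h0, ← sub_mul]
        exact mul_nonneg (sub_nonneg.2 (levelRate_le hcap i)) (hσ i)

theorem IsFeasible.integral_excessBound_le (h : IsFeasible μ Q a b q w) (hμ : ∀ i, 0 < μ i)
    (hab : a ≤ b) (i : Origin R) : IntegrableOn (excessBound μ E S q w i) (Set.Icc a b) ∧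
      ∫ t in Set.Icc a b, excessBound μ E S q w i t ≤ levelStock Q E S i := by
  induction i using leaf_induction with
  | h i ih =>
    by_cases hi : S ⊆ E i
    · rw [excessBound_of_subset hi, levelStock_of_subset hi]
      exact ⟨integrableOn_zero, by simp⟩
    · have h1 := (h.integrableOn_deriv hab i).const_mul (levelRate μ E S i)
      have h2 : IntegrableOn (fun t => q i t - levelRate μ E S i * deriv (w i) t) (Set.Icc a b) :=
        (h.integrable_q i).sub h1
      have h3 : IntegrableOn (fun t => ∑ k ∈ incoming i, excessBound μ E S q w k t)
          (Set.Icc a b) := integrable_finsetSum _ fun k hk => (ih k hk).1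
      rw [excessBound_of_not_subset hi, levelStock_of_not_subset hi]
      refine ⟨h2.add h3, ?_⟩
      rw [integral_add h2 h3, integral_sub (h.integrable_q i) h1, integral_const_mul, h.demand i,
        integral_finsetSum _ fun k hk => (ih k hk).1]
      have := Finset.sum_le_sum fun k hk => (ih k hk).2
      have := mul_nonneg (levelRate_nonneg (E := E) (S := S) hμ i) (h.integral_deriv_nonneg hab i)
      linarith

theorem IsFeasible.integrable_sum_upstream (h : IsFeasible μ Q a b q w) (i : Origin R) :
    IntegrableOn (fun t => ∑ j ∈ upstream i, q j t) (Set.Icc a b) :=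
  integrable_finsetSum _ fun j _ => h.integrable_q j

/-- Queues do not increase the amount of flow that can reach the destination during `S`. -/
theorem IsFeasible.setIntegral_sum_upstream_le (h : IsFeasible μ Q a b q w) (hμ : ∀ i, 0 < μ i)
    (hcap : ∀ i, ∑ j ∈ incoming i, μ j ≤ μ i) (hab : a ≤ b) {r : Origin R}
    (hr : Order.pred (r : R) = ⊥) :
    ∫ t in S, ∑ j ∈ upstream r, q j t ∂(volume.restrict (Set.Icc a b)) ≤
      levelRate μ E S r * (volume.restrict (Set.Icc a b)).real S + levelStock Q E S r := by
  obtain ⟨hint, hle⟩ := h.integral_excessBound_le (E := E) (S := S) hμ hab r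
  have hae := h.le_excessBound (E := E) (S := S) hcap
  calc ∫ t in S, ∑ j ∈ upstream r, q j t ∂(volume.restrict (Set.Icc a b))
      ≤ ∫ t in S, (levelRate μ E S r + excessBound μ E S q w r t)
          ∂(volume.restrict (Set.Icc a b)) := by
        refine integral_mono_ae (Integrable.restrict (h.integrable_sum_upstream r))
          ((integrable_const _).add (Integrable.restrict hint)) (ae_restrict_of_ae ?_)
        filter_upwards [hae] with t ht
        have := (ht r).2
        rw [sigmaDot_of_pred_eq_bot w hr] at this
        linarith
    _ = levelRate μ E S r * (volume.restrict (Set.Icc a b)).real S +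
          ∫ t in S, excessBound μ E S q w r t ∂(volume.restrict (Set.Icc a b)) := by
        rw [integral_add (integrable_const _) (Integrable.restrict hint), setIntegral_const, smul_eq_mul,
          mul_comm]
    _ ≤ _ := by
        gcongr
        exact (setIntegral_le_integral hint (hae.mono fun t ht => (ht r).1)).trans hle

theorem IsFeasible.le_sum_childLinks (h : IsFeasible μ Q a b q w) (i : Origin R) :
    ∀ᵐ t ∂(volume.restrict (Set.Icc a b)), q i t ≤ ∑ r ∈ childLinks (⊥ : R), μ r := by
  filter_upwards [ae_all_iff.2 h.sum_upstream_le, ae_all_iff.2 h.nonneg_q] with t h1 h2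
  calc q i t ≤ ∑ j, q j t := Finset.single_le_sum (fun j _ => h2 j) (Finset.mem_univ i)
    _ = ∑ r ∈ childLinks (⊥ : R), ∑ j ∈ upstream r, q j t := sum_univ fun j => q j t
    _ ≤ _ := Finset.sum_le_sum fun r hr => by
        have := h1 r
        rwa [sigmaDot_of_pred_eq_bot w (mem_childLinks.1 hr), mul_one] at this

theorem IsFeasible.integrable_mul (h : IsFeasible μ Q a b q w) {c : ℝ → ℝ}
    (hc : IntegrableOn c (Set.Icc a b)) (i : Origin R) :
    IntegrableOn (fun t => c t * q i t) (Set.Icc a b) := by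
  refine Integrable.mul_bdd (c := ∑ r ∈ childLinks (⊥ : R), μ r) hc (h.integrable_q i).1 ?_
  filter_upwards [h.le_sum_childLinks i, h.nonneg_q i] with t h1 h2
  rwa [Real.norm_eq_abs, abs_of_nonneg h2]

theorem IsFeasible.lpCost_eq (h : IsFeasible μ Q a b q w) {c : ℝ → ℝ} {d : Origin R → ℝ}
    (hc : IntegrableOn c (Set.Icc a b)) :
    lpCost c d a b q = ∑ r ∈ childLinks (⊥ : R),
      (∫ t in Set.Icc a b, c t * ∑ j ∈ upstream r, q j t) +
        ∑ i, (∑ j ∈ downstream i, d j) * Q i := by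
  have h1 : ∀ i, ∫ t in Set.Icc a b, (c t + ∑ j ∈ downstream i, d j) * q i t =
      (∫ t in Set.Icc a b, c t * q i t) + (∑ j ∈ downstream i, d j) * Q i := by
    intro i
    simp_rw [add_mul]
    rw [integral_add (h.integrable_mul hc i) ((h.integrable_q i).const_mul _), integral_const_mul,
      h.demand i]
  rw [lpCost, Finset.sum_congr rfl fun i _ => h1 i, Finset.sum_add_distrib, sum_univ]
  congr 1
  refine Finset.sum_congr rfl fun r _ => ?_
  rw [← integral_finsetSum _ fun j _ => h.integrable_mul hc j]
  simp_rw [Finset.mul_sum]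

theorem IsFeasible.lpCost_le_totalCost (h : IsFeasible μ Q a b q w) {c : ℝ → ℝ} {d : Origin R → ℝ}
    (hab : a ≤ b) (hc : IntegrableOn c (Set.Icc a b)) :
    lpCost c d a b q ≤ totalCost c d a b q w := by
  have hw : ∀ i, IntegrableOn (w i) (Set.Icc a b) := fun i => by
    have := (h.ac_w i).continuousOn
    rw [Set.uIcc_of_le hab] at this
    exact this.integrableOn_Icc
  have hconst : ∀ x : ℝ, IntegrableOn (fun _ => x) (Set.Icc a b) := fun x => integrable_const x
  refine Finset.sum_le_sum fun i _ => integral_mono_ae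
    (h.integrable_mul (hc.add (hconst _)) i)
    (h.integrable_mul (hc.add (integrable_finsetSum _ fun j _ => (hw j).add (hconst _))) i) ?_
  filter_upwards [h.nonneg_q i, ae_restrict_mem measurableSet_Icc] with t hq ht
  refine mul_le_mul_of_nonneg_right (add_le_add_right (Finset.sum_le_sum fun j _ => ?_) _) hq
  exact le_add_of_nonneg_left (h.nonneg_w j t ht)

theorem lpCost_eq_totalCost_zero (c : ℝ → ℝ) (d : Origin R → ℝ) (a b : ℝ) (q : Origin R → ℝ → ℝ) :
    lpCost c d a b q = totalCost c d a b q fun _ _ => 0 := by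
  simp [lpCost, totalCost]

theorem lpCost_congr {c c' : ℝ → ℝ} (d : Origin R → ℝ) (q : Origin R → ℝ → ℝ)
    (h : c =ᵐ[volume.restrict (Set.Icc a b)] c') : lpCost c d a b q = lpCost c' d a b q := by
  refine Finset.sum_congr rfl fun i _ => integral_congr_ae ?_
  filter_upwards [h] with t ht
  rw [ht]

theorem IsLPFeasible.isFeasible (h : IsLPFeasible μ Q a b q) :
    IsFeasible μ Q a b q fun _ _ => 0 where
  integrable_q := h.integrable_q
  ac_w _ := (LipschitzWith.const (0 : ℝ)).lipschitzOnWith.absolutelyContinuousOnInterval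
  nonneg_w _ _ _ := le_rfl
  init_w _ := rfl
  queue_of_pos _ := Filter.Eventually.of_forall fun _ h0 => absurd h0 (lt_irrefl _)
  queue_of_zero i := (h.capacity i).mono fun t ht _ => by simpa [sigmaDot] using ht
  demand := h.demand
  nonneg_q := h.nonneg_q
  tau_mono _ := Filter.Eventually.of_forall fun _ => by simp

/-- The flow of a threshold flow through a link to the destination is cheapest, as it arrives at the
times with the lowest schedule delay costs to the largest possible extent. -/
theorem IsFeasible.lpCost_thresholdInflow_le (h : IsFeasible μ Q a b q w) (hμ : ∀ i, 0 < μ i)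
    (hcap : ∀ i, ∑ j ∈ incoming i, μ j ≤ μ i) (hab : a ≤ b)
    {c : ℝ → ℝ} (d : Origin R → ℝ) (hcm : Measurable c) (hc0 : ∀ t, 0 ≤ c t)
    (hc : IntegrableOn c (Set.Icc a b)) (hE : ∀ i, MeasurableSet (E i))
    (hcomp : ∀ i s, {t | c t ≤ s} ⊆ E i ∨ E i ⊆ {t | c t ≤ s})
    (h₀ : IsFeasible μ Q a b (thresholdInflow μ E) fun _ _ => 0) :
    lpCost c d a b (thresholdInflow μ E) ≤ lpCost c d a b q := by
  rw [h.lpCost_eq hc, h₀.lpCost_eq hc]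
  refine add_le_add_left (Finset.sum_le_sum fun r hr => ?_) _
  refine integral_mul_le_of_setIntegral_sublevel_le hcm hc0 (h.integrable_sum_upstream r)
    (h₀.integrable_sum_upstream r) ?_ ?_ ?_ ?_ fun s => ?_
  · filter_upwards [ae_all_iff.2 h.nonneg_q] with t ht
    exact Finset.sum_nonneg fun j _ => ht j
  · filter_upwards [ae_all_iff.2 h₀.nonneg_q] with t ht
    exact Finset.sum_nonneg fun j _ => ht j
  · simp_rw [Finset.mul_sum]
    exact integrable_finsetSum _ fun j _ => h.integrable_mul hc j
  · rw [integral_finsetSum _ fun j _ => h.integrable_q j,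
      integral_finsetSum _ fun j _ => h₀.integrable_q j]
    exact Finset.sum_congr rfl fun j _ => (h.demand j).trans (h₀.demand j).symm
  · refine (h.setIntegral_sum_upstream_le (E := E) hμ hcap hab (mem_childLinks.1 hr)).trans ?_
    simp_rw [sum_upstream_thresholdInflow]
    rw [setIntegral_thresholdFlow (S := {t | c t ≤ s}) hμ hcap hE _ h₀.demand
      (hcm measurableSet_Iic) fun i => hcomp i s]

end dso

end TreeDSO

theorem corollary2 (R : RootedTree) [Fintype (TreeDSO.Origin R)]
    (μ Q : TreeDSO.Origin R → ℝ)
    (hμ : ∀ i, 0 < μ i)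
    (hcap : ∀ i, ∑ j ∈ TreeDSO.incoming i, μ j ≤ μ i)
    (hQ : ∀ i, 0 ≤ Q i) :
    ∃ T₀ : ℝ, 0 < T₀ ∧ ∀ a b : ℝ, T₀ ≤ b - a →
      ∀ (c : ℝ → ℝ) (d : TreeDSO.Origin R → ℝ),
        (∀ t ∈ Set.Icc a b, 0 ≤ c t) → MeasureTheory.IntegrableOn c (Set.Icc a b) →
        ∃ q w : TreeDSO.Origin R → ℝ → ℝ,
          TreeDSO.IsOptimal μ Q c d a b q w ∧
          (∀ i t, w i t = 0) ∧ TreeDSO.IsLPOptimal μ Q c d a b q := by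
  have hterm : ∀ i, 0 ≤ (∑ j ∈ TreeDSO.upstream i, Q j) / μ i := fun i =>
    div_nonneg (Finset.sum_nonneg fun j _ => hQ j) (hμ i).le
  refine ⟨1 + ∑ i, (∑ j ∈ TreeDSO.upstream i, Q j) / μ i,
    add_pos_of_pos_of_nonneg one_pos (Finset.sum_nonneg fun i _ => hterm i), ?_⟩
  intro a b hT c d hc0 hc
  have hsum := Finset.sum_nonneg fun i (_ : i ∈ Finset.univ) => hterm i
  have hab : a ≤ b := by linarith
  have hlen : ∀ i, ∑ j ∈ TreeDSO.upstream i, Q j ≤ μ i * (b - a) := fun i => by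
    have h1 := Finset.single_le_sum (fun i _ => hterm i) (Finset.mem_univ i)
    rw [← div_le_iff₀' (hμ i)]
    linarith
  -- Costs only matter almost everywhere, so `c` may be taken measurable and nonnegative everywhere.
  obtain ⟨c', hc'm, hc'0, hcc'⟩ : ∃ c' : ℝ → ℝ, Measurable c' ∧ (∀ t, 0 ≤ c' t) ∧
      c =ᵐ[volume.restrict (Set.Icc a b)] c' := by
    refine ⟨fun t => max (hc.1.mk c t) 0, hc.1.stronglyMeasurable_mk.measurable.max
      measurable_const, fun t => le_max_right _ _, ?_⟩
    filter_upwards [hc.1.ae_eq_mk, ae_restrict_mem measurableSet_Icc] with t h1 ht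
    rw [← h1, max_eq_left (hc0 t ht)]
  have hc' : IntegrableOn c' (Set.Icc a b) := hc.congr hcc'
  obtain ⟨E, hE, hcomp, hdem⟩ := TreeDSO.exists_thresholdFlow hμ hcap hQ hab hlen hc'm
  have hLP : TreeDSO.IsLPFeasible μ Q a b (TreeDSO.thresholdInflow μ E) :=
    { integrable_q := fun i => TreeDSO.integrable_thresholdInflow hμ hcap hE _ i
      capacity := fun i => Filter.Eventually.of_forall fun t => by
        rw [TreeDSO.sum_upstream_thresholdInflow]
        exact TreeDSO.thresholdFlow_le hcap i t
      demand := hdem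
      nonneg_q := fun i => Filter.Eventually.of_forall fun t =>
        TreeDSO.thresholdInflow_nonneg hcap i t }
  have hopt : ∀ q w, TreeDSO.IsFeasible μ Q a b q w →
      TreeDSO.lpCost c d a b (TreeDSO.thresholdInflow μ E) ≤ TreeDSO.lpCost c d a b q := by
    intro q w h
    rw [TreeDSO.lpCost_congr d _ hcc', TreeDSO.lpCost_congr d _ hcc']
    exact h.lpCost_thresholdInflow_le hμ hcap hab d hc'm hc'0 hc' hE hcomp hLP.isFeasible
  refine ⟨TreeDSO.thresholdInflow μ E, fun _ _ => 0, ⟨hLP.isFeasible, fun q w h => ?_⟩,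
    fun _ _ => rfl, hLP, fun q h => hopt q _ h.isFeasible⟩
  rw [← TreeDSO.lpCost_eq_totalCost_zero]
  exact (hopt q w h).trans (h.lpCost_le_totalCost hab hc)
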